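/- Let $S_3$ act on $\mathbb{P}^2_{\mathbb{C}}$ by permuting the homogeneous coordinates. Let $f,g\in\mathbb{C}[X_0,X_1,X_2]$ be nonzero symmetric homogeneous polynomials of degrees $d\ge 1$ and $e\ge 1$, with corresponding symmetric curves $C=V(f)$ and $D=V(g)$ in $\mathbb{P}^2_{\mathbb{C}}$. Assume that $C$ and $D$ are transverse: at every common point $P$ of $C$ and $D$ both curves are smooth with distinct tangent lines, i.e. the vectors $\nabla f(P)$ and $\nabla g(P)$ in $\mathbb{C}^3$ are linearly independent. Let $C_2\subset S_3$ be a subgroup generated by a transposition and $C_3\subset S_3$ the subgroup generated by a $3$-cycle, and write $[S_3/H]$ for the isomorphism class of the transitive $S_3$-set $S_3/H$, $[S_3]$ for that of $S_3$ acting on itself by left multiplication, and $+$ for disjoint union. Then for every integer $k\ge 0$: - if $de=6k$, then $C\cap D\cong k[S_3]$ as an $S_3$-set; - $de\ne 6k+1$ (no transverse intersection with such degrees exists); - if $de=6k+2$, then $C\cap D\cong k[S_3]+[S_3/C_3]$; - if $de=6k+3$, then $C\cap D\cong k[S_3]+[S_3/C_2]$; - $de\ne 6k+4$ (no transverse intersection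 with such degrees exists); - if $de=6k+5$, then $C\cap D\cong k[S_3]+[S_3/C_2]+[S_3/C_3]$. -/

import Mathlib

namespace SymmetricBezout

open MvPolynomial
open scoped LinearAlgebra.Projectivization

/-- The symmetric group on three letters. -/
abbrev S3 : Type := Equiv.Perm (Fin 3)

/-- The complex projective plane, as the set of lines in `ℂ³`. -/
abbrev P2 : Type := ℙ ℂ (Fin 3 → ℂ)

/-- `σ` permutes the coordinates of `ℂ³`: the `i`-th coordinate of the image of `v` is
the `σ⁻¹ i`-th coordinate of `v`. -/
noncomputable def permCoords (σ : S3) : (Fin 3 → ℂ) →ₗ[ℂ] (Fin 3 → ℂ) :=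
  LinearMap.funLeft ℂ ℂ (⇑σ⁻¹)

@[simp] theorem permCoords_apply (σ : S3) (v : Fin 3 → ℂ) (i : Fin 3) :
    permCoords σ v i = v (σ⁻¹ i) := rfl

theorem permCoords_injective (σ : S3) : Function.Injective (permCoords σ) :=
  LinearMap.funLeft_injective_of_surjective ℂ ℂ _ (σ⁻¹).surjective

/-- The left action of `S3` on the projective plane that permutes the homogeneous coordinates. -/
noncomputable instance permAction : MulAction S3 P2 where
  smul σ P := Projectivization.map (permCoords σ) (permCoords_injective σ) P
  one_smul P := by
    induction P using Projectivization.ind with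
    | h v hv => rfl
  mul_smul σ τ P := by
    induction P using Projectivization.ind with
    | h v hv => rfl

theorem smul_def (σ : S3) (P : P2) :
    σ • P = Projectivization.map (permCoords σ) (permCoords_injective σ) P := rfl

/-- The zero locus in the projective plane of a homogeneous polynomial: the lines in `ℂ³` on
which the polynomial vanishes. -/
def zeroLocus (f : MvPolynomial (Fin 3) ℂ) : Set P2 :=
  {P | ∀ v ∈ P.submodule, eval v f = 0}

/-- For homogeneous polynomials, vanishing at a point can be tested on any homogeneous
coordinates of that point. -/
theorem mk_mem_zeroLocus_iff {f : MvPolynomial (Fin 3) ℂ} {d : ℕ} (hf : f.IsHomogeneous d)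
    (v : Fin 3 → ℂ) (hv : v ≠ 0) :
    Projectivization.mk ℂ v hv ∈ zeroLocus f ↔ eval v f = 0 := by
  constructor
  · intro h
    exact h v (by rw [Projectivization.submodule_mk]; exact Submodule.mem_span_singleton_self v)
  · intro h w hw
    rw [Projectivization.submodule_mk, Submodule.mem_span_singleton] at hw
    obtain ⟨c, rfl⟩ := hw
    have hc : eval (c • v) f = c ^ d * eval v f := by
      rw [eval_eq', eval_eq', Finset.mul_sum]
      refine Finset.sum_congr rfl fun m hm => ?_
      have hdeg := hf (mem_support_iff.mp hm)
      have hsum : ∑ i, m i = d := by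
        rw [← hdeg, ← Finsupp.degree_eq_sum, Finsupp.degree_eq_weight_one]
        rfl
      simp only [Pi.smul_apply, smul_eq_mul, mul_pow, Finset.prod_mul_distrib,
        Finset.prod_pow_eq_pow_sum]
      rw [hsum]
      ring
    rw [hc, h, mul_zero]

/-- The intersection of the zero loci of two symmetric polynomials, with the action of `S3`
inherited from the projective plane. -/
noncomputable def intersectionLocus (f g : MvPolynomial (Fin 3) ℂ) (hf : f.IsSymmetric) (hg : g.IsSymmetric) :
    SubMulAction S3 P2 where
  carrier := zeroLocus f ∩ zeroLocus g
  smul_mem' := by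
    have key : ∀ h : MvPolynomial (Fin 3) ℂ, h.IsSymmetric → ∀ (σ : S3) (P : P2),
        P ∈ zeroLocus h → σ • P ∈ zeroLocus h := by
      intro h hh σ P hP
      induction P using Projectivization.ind with
      | h v hv =>
        intro w hw
        rw [smul_def, Projectivization.map_mk, Projectivization.submodule_mk,
          Submodule.mem_span_singleton] at hw
        obtain ⟨c, rfl⟩ := hw
        have h1 := hP (c • v) (by
          rw [Projectivization.submodule_mk]
          exact Submodule.smul_mem _ _ (Submodule.mem_span_singleton_self v))
        rw [← hh σ⁻¹, eval_rename] at h1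
        exact h1
    exact fun σ P hP => ⟨key f hf σ P hP.1, key g hg σ P hP.2⟩

/-- The vector of partial derivatives of `f` at `v`. -/
noncomputable def gradVec (f : MvPolynomial (Fin 3) ℂ) (v : Fin 3 → ℂ) : Fin 3 → ℂ :=
  fun i => eval v (pderiv i f)

/-- The projective plane curves `f = 0` and `g = 0` are transverse: at each common point both are
smooth and their tangent lines, whose coefficients are the partial derivatives, are distinct. -/
def Transverse (f g : MvPolynomial (Fin 3) ℂ) : Prop :=
  ∀ v : Fin 3 → ℂ, v ≠ 0 → eval v f = 0 → eval v g = 0 →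
    LinearIndependent ℂ ![gradVec f v, gradVec g v]

/-- The subgroup of order two generated by a transposition. -/
def C2 : Subgroup S3 := Subgroup.zpowers (Equiv.swap 0 1)

/-- The subgroup of order three generated by a three-cycle. -/
def C3 : Subgroup S3 := Subgroup.zpowers (finRotate 3)

/-- The `S3`-set `k[S3] + a[S3/C2] + b[S3/C3]`: the disjoint union of `k` copies of `S3`, `a`
copies of `S3/C2` and `b` copies of `S3/C3`, with `S3` acting on each copy by left
multiplication. -/
abbrev OrbitSum (k a b : ℕ) : Type :=
  (Σ _ : Fin k, S3) ⊕ (Σ _ : Fin a, S3 ⧸ C2) ⊕ (Σ _ : Fin b, S3 ⧸ C3)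

/-- Two `S3`-sets are isomorphic: there is an equivariant bijection between them. -/
def Isomorphic (X Y : Type) [MulAction S3 X] [MulAction S3 Y] : Prop :=
  ∃ φ : X ≃ Y, ∀ (σ : S3) (x : X), φ (σ • x) = σ • φ x

end SymmetricBezout

/-!
Transverse curves meet in exactly `d * e` points. Indeed, for `n` large the forms of degree `n` in
`(f, g)` have codimension `d * e`, since `f` and `g` are relatively prime, while the forms of degree
`n` vanishing on the intersection have codimension the number of its points. By transversality
`f` and `g` generate the ideal of every intersection point locally, so the Nullstellensatz makes
the two spaces agree.

At a common zero `v` the gradients of `f` and `g` are orthogonal to `v` by Euler's identity, so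
their cross product is a nonzero multiple of `v`. If `v` is fixed by an odd permutation, then by
symmetry so are both gradients, but the permutation changes the sign of their cross product: a
contradiction. So a transposition fixes at most one intersection point, `[1 : -1 : 0]` for `(0 1)`,
a three-cycle fixes at most the two points `[1 : ω : ω²]` with `ω` a primitive cube root of unity,
and no point is fixed by all of `S3`. As `(0 1)` has a fixed point in `S3 / C2`, and the
three-cycle has two in `S3 / C3`, each of these orbit types occurs at most once, and `d * e`
determines the number of orbits of each type.
-/

namespace SymmetricBezout

open MvPolynomial
open scoped LinearAlgebra.Projectivization Matrix

attribute [local instance] MvPolynomial.gradedAlgebra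

section HomogeneousPolynomials

variable {σ R : Type*}

theorem eval₂_smul_of_isHomogeneous {A : Type*} [CommSemiring R] [CommSemiring A] (φ : R →+* A)
    {f : MvPolynomial σ R} {d : ℕ} (hf : f.IsHomogeneous d) (c : A) (x : σ → A) :
    eval₂ φ (c • x) f = c ^ d * eval₂ φ x f := by
  rw [eval₂_eq, eval₂_eq, Finset.mul_sum]
  refine Finset.sum_congr rfl fun m hm => ?_
  simp only [Pi.smul_apply, smul_eq_mul, mul_pow, Finset.prod_mul_distrib,
    Finset.prod_pow_eq_pow_sum]
  rw [hf.degree_eq_sum_deg_support hm, mul_left_comm]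

theorem eval_smul_of_isHomogeneous [CommSemiring R] {f : MvPolynomial σ R} {d : ℕ}
    (hf : f.IsHomogeneous d) (c : R) (x : σ → R) : eval (c • x) f = c ^ d * eval x f :=
  eval₂_smul_of_isHomogeneous (RingHom.id R) hf c x

theorem homogeneousComponent_mul_of_isHomogeneous [CommSemiring R] {f : MvPolynomial σ R} {d : ℕ}
    (hf : f.IsHomogeneous d) (a : MvPolynomial σ R) (n : ℕ) :
    homogeneousComponent (n + d) (a * f) = homogeneousComponent n a * f := by
  have hdec (p : MvPolynomial σ R) (m : ℕ) :
      (DirectSum.decompose (homogeneousSubmodule σ R) p m : MvPolynomial σ R) =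
        homogeneousComponent m p :=
    decomposition.decompose'_apply p m
  rw [← hdec, ← hdec, DirectSum.coe_decompose_mul_of_right_mem_of_le (homogeneousSubmodule σ R)
    hf (Nat.le_add_left d n), Nat.add_sub_cancel]

theorem isHomogeneous_span_pair [CommSemiring R] {f g : MvPolynomial σ R} {d e : ℕ}
    (hf : f.IsHomogeneous d) (hg : g.IsHomogeneous e) :
    (Ideal.span {f, g}).IsHomogeneous (homogeneousSubmodule σ R) := by
  refine Ideal.homogeneous_span _ _ ?_
  rintro x (rfl | rfl)
  exacts [⟨d, hf⟩, ⟨e, hg⟩]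

theorem totalDegree_sum_range_homogeneousComponent_le [CommSemiring R] (p : MvPolynomial σ R)
    (N : ℕ) : (∑ i ∈ Finset.range N, homogeneousComponent i p).totalDegree ≤ N :=
  (totalDegree_finsetSum _ _).trans <| Finset.sup_le fun i hi =>
    (homogeneousComponent_isHomogeneous i p).totalDegree_le.trans (Finset.mem_range.1 hi).le

variable [CommRing R]

theorem sub_sum_range_homogeneousComponent_mem (p : MvPolynomial σ R) (N : ℕ) :
    p - ∑ i ∈ Finset.range N, homogeneousComponent i p ∈ idealOfVars σ R ^ N := by
  classical
  refine (mem_pow_idealOfVars_iff' N _).2 fun m hm => ?_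
  simp only [coeff_sub, coeff_sum, coeff_homogeneousComponent]
  rw [Finset.sum_ite_eq, if_pos (Finset.mem_range.2 hm), sub_self]

variable {I J : Ideal (MvPolynomial σ R)} {N : ℕ}

theorem homogeneousComponent_mul_mem (hI : I.IsHomogeneous (homogeneousSubmodule σ R))
    (hIJ : idealOfVars σ R ^ N * J ≤ I) {s : MvPolynomial σ R} (hs : s ∈ J)
    (a : MvPolynomial σ R) {n : ℕ} (hn : N + s.totalDegree < n) :
    homogeneousComponent n (a * s) ∈ I := by
  set low := ∑ i ∈ Finset.range N, homogeneousComponent i a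
  have hlow : (low * s).totalDegree < n :=
    ((totalDegree_mul _ _).trans
      (by gcongr; exact totalDegree_sum_range_homogeneousComponent_le a N)).trans_lt hn
  rw [show a * s = low * s + (a - low) * s by ring, map_add,
    homogeneousComponent_eq_zero _ _ hlow, zero_add]
  exact homogeneousComponent_mem_of_mem hI
    (hIJ (Ideal.mul_mem_mul (sub_sum_range_homogeneousComponent_mem a N) hs)) n

theorem exists_forall_isHomogeneous_mem (hI : I.IsHomogeneous (homogeneousSubmodule σ R))
    (hJ : J.FG) (hIJ : idealOfVars σ R ^ N * J ≤ I) :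
    ∃ n₀, ∀ n ≥ n₀, ∀ h ∈ J, h.IsHomogeneous n → h ∈ I := by
  obtain ⟨S, rfl⟩ := hJ
  refine ⟨N + S.sup totalDegree + 1, fun n hn h hS hh => ?_⟩
  obtain ⟨a, -, rfl⟩ := Submodule.mem_span_finset.1 hS
  rw [← homogeneousComponent_eq_self hh, map_sum]
  refine Ideal.sum_mem _ fun s hs => homogeneousComponent_mul_mem hI hIJ (Ideal.subset_span hs) _ ?_
  have : s.totalDegree ≤ S.sup totalDegree := Finset.le_sup hs
  omega

end HomogeneousPolynomials

section HilbertFunction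

variable {σ K : Type*} [Field K]

theorem finrank_homogeneousSubmodule [Fintype σ] (n : ℕ) :
    Module.finrank K (homogeneousSubmodule σ K n) = (Fintype.card σ + n - 1).choose n := by
  classical
  have hset : {m : σ →₀ ℕ | m.degree = n} = (Finset.univ : Finset σ).finsuppAntidiag n := by
    ext m
    simp [Finset.mem_finsuppAntidiag, Finsupp.degree_eq_sum]
  rw [homogeneousSubmodule_eq_finsupp_supported, hset,
    (AddMonoidAlgebra.supportedEquivFinsupp _).finrank_eq, Module.finrank_finsupp_self]
  simp [Finset.card_finsuppAntidiag_nat_eq_choose]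

instance finiteDimensional_homogeneousSubmodule [Finite σ] (n : ℕ) :
    FiniteDimensional K (homogeneousSubmodule σ K n) :=
  Module.Finite.iff_fg.2 (homogeneousSubmodule_fg σ K n)

theorem finrank_map_mulRight {A : Type*} [Ring A] [IsDomain A] [Algebra K A] {a : A} (ha : a ≠ 0)
    (V : Submodule K A) :
    Module.finrank K (V.map (LinearMap.mulRight K a)) = Module.finrank K V :=
  (Submodule.equivMapOfInjective _ (mul_left_injective₀ ha) V).finrank_eq.symm

theorem span_pair_inf_homogeneousSubmodule {R : Type*} [CommRing R] {f g : MvPolynomial σ R}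
    {d e : ℕ} (hf : f.IsHomogeneous d) (hg : g.IsHomogeneous e) (t : ℕ) :
    (Ideal.span {f, g}).restrictScalars R ⊓ homogeneousSubmodule σ R (t + d + e) =
      (homogeneousSubmodule σ R (t + e)).map (LinearMap.mulRight R f) ⊔
        (homogeneousSubmodule σ R (t + d)).map (LinearMap.mulRight R g) := by
  have hdeg : t + d + e = t + e + d := Nat.add_right_comm t d e
  apply le_antisymm
  · rintro h ⟨hI, hh⟩
    obtain ⟨a, b, rfl⟩ := Ideal.mem_span_pair.1 hI
    rw [← homogeneousComponent_eq_self hh, map_add, homogeneousComponent_mul_of_isHomogeneous hg b,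
      hdeg, homogeneousComponent_mul_of_isHomogeneous hf a]
    exact Submodule.add_mem_sup ⟨_, homogeneousComponent_mem _ _, rfl⟩
      ⟨_, homogeneousComponent_mem _ _, rfl⟩
  · refine sup_le ?_ ?_ <;> rintro _ ⟨a, ha, rfl⟩
    · exact ⟨Ideal.mul_mem_left _ _ (Ideal.subset_span (by simp)), hdeg ▸ IsHomogeneous.mul ha hf⟩
    · exact ⟨Ideal.mul_mem_left _ _ (Ideal.subset_span (by simp)), IsHomogeneous.mul ha hg⟩

theorem map_mulRight_inf_map_mulRight {f g : MvPolynomial σ K} {d e : ℕ} (hf : f.IsHomogeneous d)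
    (hg : g.IsHomogeneous e) (hfg : IsRelPrime f g) (t : ℕ) :
    (homogeneousSubmodule σ K (t + e)).map (LinearMap.mulRight K f) ⊓
        (homogeneousSubmodule σ K (t + d)).map (LinearMap.mulRight K g) =
      (homogeneousSubmodule σ K t).map (LinearMap.mulRight K (f * g)) := by
  apply le_antisymm
  · rintro _ ⟨⟨a, ha, rfl⟩, b, -, hab⟩
    simp only [LinearMap.mulRight_apply] at hab ⊢
    obtain ⟨c, rfl⟩ : g ∣ a := hfg.symm.dvd_of_dvd_mul_right ⟨b, by rw [← hab, mul_comm]⟩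
    refine ⟨homogeneousComponent t c, homogeneousComponent_mem _ _, ?_⟩
    have hgc : g * c = homogeneousComponent t c * g := by
      rw [← homogeneousComponent_mul_of_isHomogeneous hg, mul_comm c g,
        homogeneousComponent_eq_self ha]
    rw [LinearMap.mulRight_apply, hgc, mul_assoc, mul_comm f g]
  · rintro _ ⟨c, hc, rfl⟩
    exact ⟨⟨c * g, IsHomogeneous.mul hc hg, by simp only [LinearMap.mulRight_apply]; ring⟩,
      c * f, IsHomogeneous.mul hc hf, by simp only [LinearMap.mulRight_apply]; ring⟩

theorem choose_two_add_choose_two (t d e : ℕ) :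
    (t + d + e + 2).choose 2 + (t + 2).choose 2 =
      (t + e + 2).choose 2 + (t + d + 2).choose 2 + d * e := by
  have hchoose (n : ℕ) : ((n + 2).choose 2 : ℚ) = (n + 2) * (n + 1) / 2 := by
    rw [Nat.cast_choose_two]
    push_cast
    ring
  qify
  simp only [hchoose]
  push_cast
  ring

theorem finrank_homogeneousSubmodule_fin_three (n : ℕ) :
    Module.finrank K (homogeneousSubmodule (Fin 3) K n) = (n + 2).choose 2 := by
  rw [finrank_homogeneousSubmodule, Fintype.card_fin, show 3 + n - 1 = n + 2 by omega,
    Nat.choose_symm_add]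

theorem finrank_span_pair_inf_add_mul {f g : MvPolynomial (Fin 3) K} {d e : ℕ}
    (hf : f.IsHomogeneous d) (hg : g.IsHomogeneous e) (hf0 : f ≠ 0) (hg0 : g ≠ 0)
    (hfg : IsRelPrime f g) {n : ℕ} (hn : d + e ≤ n) :
    Module.finrank K ↥((Ideal.span {f, g}).restrictScalars K ⊓
        homogeneousSubmodule (Fin 3) K n) + d * e =
      Module.finrank K (homogeneousSubmodule (Fin 3) K n) := by
  obtain ⟨t, rfl⟩ : ∃ t, n = t + d + e := ⟨n - d - e, by omega⟩
  have hsup := Submodule.finrank_sup_add_finrank_inf_eq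
    ((homogeneousSubmodule (Fin 3) K (t + e)).map (LinearMap.mulRight K f))
    ((homogeneousSubmodule (Fin 3) K (t + d)).map (LinearMap.mulRight K g))
  rw [map_mulRight_inf_map_mulRight hf hg hfg, ← span_pair_inf_homogeneousSubmodule hf hg,
    finrank_map_mulRight hf0, finrank_map_mulRight hg0,
    finrank_map_mulRight (mul_ne_zero hf0 hg0)] at hsup
  simp only [finrank_homogeneousSubmodule_fin_three] at hsup ⊢
  have := choose_two_add_choose_two t d e
  omega

end HilbertFunction

section Interpolation

variable {σ K : Type*} [Field K]

theorem exists_linear_form_separating {P Q : ℙ K (σ → K)} (hPQ : P ≠ Q) :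
    ∃ l : MvPolynomial σ K, l.IsHomogeneous 1 ∧ eval P.rep l ≠ 0 ∧ eval Q.rep l = 0 := by
  obtain ⟨i, hi⟩ := Function.ne_iff.1 Q.rep_nonzero
  obtain ⟨j, hj⟩ : ∃ j, Q.rep i * P.rep j ≠ Q.rep j * P.rep i := by
    by_contra! h
    refine hPQ ?_
    rw [← P.mk_rep, ← Q.mk_rep, Projectivization.mk_eq_mk_iff']
    refine ⟨P.rep i / Q.rep i, funext fun j => ?_⟩
    rw [Pi.smul_apply, smul_eq_mul, div_mul_eq_mul_div, mul_comm, ← h j, mul_div_cancel_left₀ _ hi]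
  refine ⟨C (Q.rep i) * X j - C (Q.rep j) * X i,
    (isHomogeneous_C_mul_X _ _).sub (isHomogeneous_C_mul_X _ _), ?_, ?_⟩
  · simpa [sub_eq_zero] using hj
  · simp [mul_comm]

theorem exists_form_interpolating (T : Finset (ℙ K (σ → K))) {n : ℕ} (hn : T.card ≤ n)
    (P : ℙ K (σ → K)) :
    ∃ h : MvPolynomial σ K, h.IsHomogeneous n ∧ eval P.rep h ≠ 0 ∧
      ∀ Q ∈ T, Q ≠ P → eval Q.rep h = 0 := by
  have hsep (Q) : ∃ l : MvPolynomial σ K, l.IsHomogeneous 1 ∧ eval P.rep l ≠ 0 ∧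
      (Q ≠ P → eval Q.rep l = 0) := by
    by_cases hQ : Q = P
    · obtain ⟨i, hi⟩ := Function.ne_iff.1 P.rep_nonzero
      exact ⟨X i, isHomogeneous_X _ i, by simpa using hi, fun h => (h hQ).elim⟩
    · obtain ⟨l, hl, hlP, hlQ⟩ := exists_linear_form_separating (Ne.symm hQ)
      exact ⟨l, hl, hlP, fun _ => hlQ⟩
  choose l hl hlP hlQ using hsep
  refine ⟨(∏ Q ∈ T, l Q) * l P ^ (n - T.card), ?_, ?_, fun Q hQ hQP => ?_⟩
  · have := (IsHomogeneous.prod T l (fun _ => 1) fun Q _ => hl Q).mul ((hl P).pow (n - T.card))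
    simpa [Nat.add_sub_cancel' hn] using this
  · rw [map_mul, map_pow, map_prod]
    exact mul_ne_zero (Finset.prod_ne_zero_iff.2 fun Q _ => hlP Q) (pow_ne_zero _ (hlP P))
  · rw [map_mul, map_prod, Finset.prod_eq_zero hQ (hlQ Q hQP), zero_mul]

/-- Evaluation of polynomials at the points of `T`, each represented by the homogeneous
coordinates `Projectivization.rep`. -/
noncomputable def evalRep (T : Finset (ℙ K (σ → K))) : MvPolynomial σ K →ₗ[K] (T → K) :=
  LinearMap.pi fun P => (aeval (R := K) P.1.rep).toLinearMap

theorem evalRep_apply (T : Finset (ℙ K (σ → K))) (h : MvPolynomial σ K) (P : T) :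
    evalRep T h P = eval P.1.rep h := by
  simp [evalRep]

theorem mem_ker_evalRep {T : Finset (ℙ K (σ → K))} {h : MvPolynomial σ K} :
    h ∈ LinearMap.ker (evalRep T) ↔ ∀ P ∈ T, eval P.rep h = 0 := by
  simp [funext_iff, evalRep_apply]

theorem evalRep_domRestrict_surjective (T : Finset (ℙ K (σ → K))) {n : ℕ} (hn : T.card ≤ n) :
    Function.Surjective ((evalRep T).domRestrict (homogeneousSubmodule σ K n)) := by
  choose h hh hP hQ using exists_form_interpolating T hn
  intro y
  refine ⟨∑ P : T, (y P / eval P.1.rep (h P)) • ⟨h P, hh P⟩, funext fun Q => ?_⟩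
  rw [map_sum, Finset.sum_apply, Finset.sum_eq_single_of_mem Q (Finset.mem_univ _)]
  · simp [evalRep_apply, hP Q.1]
  · intro P _ hPQ
    simp [evalRep_apply, hQ P Q Q.2 (Subtype.coe_ne_coe.2 hPQ.symm)]

theorem card_add_finrank_inf_ker_evalRep [Finite σ] (T : Finset (ℙ K (σ → K))) {n : ℕ}
    (hn : T.card ≤ n) :
    T.card + Module.finrank K ↥(LinearMap.ker (evalRep T) ⊓ homogeneousSubmodule σ K n) =
      Module.finrank K (homogeneousSubmodule σ K n) := by
  rw [← LinearMap.finrank_range_add_finrank_ker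
      ((evalRep T).domRestrict (homogeneousSubmodule σ K n)),
    LinearMap.range_eq_top.2 (evalRep_domRestrict_surjective T hn), LinearMap.ker_domRestrict,
    ← Submodule.finrank_map_subtype_eq, Submodule.map_comap_subtype, inf_comm]
  simp

end Interpolation

section LocalStructure

/-- The vector of partial derivatives of `f` at `x`; it generalizes `gradVec`. -/
noncomputable def gradient {σ R : Type*} [CommSemiring R] (f : MvPolynomial σ R) (x : σ → R) :
    σ → R :=
  fun i => eval x (pderiv i f)

/-- The ideal generated by the `2 × 2` minors of the matrix with rows `v` and `X`. For `v ≠ 0` it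
is the homogeneous ideal of the point of projective space with homogeneous coordinates `v`. -/
noncomputable def pointIdeal {σ R : Type*} [CommRing R] (v : σ → R) : Ideal (MvPolynomial σ R) :=
  Ideal.span (Set.range fun p : σ × σ => C (v p.1) * X p.2 - C (v p.2) * X p.1)

theorem minor_mem_pointIdeal {σ R : Type*} [CommRing R] (v : σ → R) (i j : σ) :
    C (v i) * X j - C (v j) * X i ∈ pointIdeal v :=
  Ideal.subset_span ⟨(i, j), rfl⟩

theorem mem_pointIdeal_of_isHomogeneous {σ K : Type*} [Field K] {v : σ → K} (hv : v ≠ 0)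
    {f : MvPolynomial σ K} {d : ℕ} (hf : f.IsHomogeneous d) (h : eval v f = 0) :
    f ∈ pointIdeal v := by
  obtain ⟨i, hi⟩ := Function.ne_iff.1 hv
  set φ := Ideal.Quotient.mk (pointIdeal v)
  have hX : φ (C (v i)) • (φ ∘ X) = φ (X i) • (φ ∘ C ∘ v) := by
    ext j
    simpa [φ, mul_comm] using Ideal.Quotient.eq.2 (minor_mem_pointIdeal v i j)
  have hfX : eval₂ (φ.comp C) (φ ∘ X) f = φ f := by rw [← eval₂_comp_left, eval₂_eta]
  have hfv : eval₂ (φ.comp C) (φ ∘ C ∘ v) f = φ (C (eval v f)) :=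
    (eval₂_comp_left (φ.comp C) (RingHom.id K) v f).symm
  have hscale : φ (C (v i)) ^ d * φ f = 0 := by
    rw [← hfX, ← eval₂_smul_of_isHomogeneous _ hf, hX, eval₂_smul_of_isHomogeneous _ hf, hfv, h,
      map_zero, map_zero, mul_zero]
  have hunit : IsUnit (φ (C (v i)) ^ d) := (((IsUnit.mk0 _ hi).map C).map φ).pow d
  exact Ideal.Quotient.eq_zero_iff_mem.1 (hunit.mul_right_eq_zero.1 hscale)

variable {R : Type*} [CommRing R]

theorem pointIdeal_eq_span_cross (v : Fin 3 → R) :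
    pointIdeal v = Ideal.span (Set.range (C ∘ v ⨯₃ (X : Fin 3 → MvPolynomial (Fin 3) R))) := by
  set I := Ideal.span (Set.range (C ∘ v ⨯₃ (X : Fin 3 → MvPolynomial (Fin 3) R)))
  refine le_antisymm (Ideal.span_le.2 ?_) (Ideal.span_le.2 ?_)
  · have h12 : C (v 1) * X 2 - C (v 2) * X 1 ∈ I := Ideal.subset_span ⟨0, rfl⟩
    have h20 : C (v 2) * X 0 - C (v 0) * X 2 ∈ I := Ideal.subset_span ⟨1, rfl⟩
    have h01 : C (v 0) * X 1 - C (v 1) * X 0 ∈ I := Ideal.subset_span ⟨2, rfl⟩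
    rintro _ ⟨⟨i, j⟩, rfl⟩
    match i, j with
    | 0, 0 | 1, 1 | 2, 2 => simp
    | 0, 1 => exact h01
    | 1, 2 => exact h12
    | 2, 0 => exact h20
    | 1, 0 => exact sub_mem_comm_iff.1 h01
    | 2, 1 => exact sub_mem_comm_iff.1 h12
    | 0, 2 => exact sub_mem_comm_iff.1 h20
  · rintro _ ⟨i, rfl⟩
    fin_cases i
    exacts [minor_mem_pointIdeal v 1 2, minor_mem_pointIdeal v 2 0, minor_mem_pointIdeal v 0 1]

theorem mem_pointIdeal_iff {v : Fin 3 → R} {f : MvPolynomial (Fin 3) R} :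
    f ∈ pointIdeal v ↔ ∃ A : Fin 3 → MvPolynomial (Fin 3) R, A ⬝ᵥ (C ∘ v ⨯₃ X) = f := by
  rw [pointIdeal_eq_span_cross]
  exact Ideal.mem_span_range_iff_exists_fun

theorem gradient_dotProduct_cross (v : Fin 3 → R) (A : Fin 3 → MvPolynomial (Fin 3) R) :
    gradient (A ⬝ᵥ (C ∘ v ⨯₃ X)) v = (eval v ∘ A) ⨯₃ v := by
  ext i
  fin_cases i <;>
    simp [gradient, dotProduct, Fin.sum_univ_three, cross_apply, pderiv_X] <;> ring

theorem cross_cross_cross (a b v : Fin 3 → R) :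
    (a ⨯₃ v) ⨯₃ (b ⨯₃ v) = (a ⬝ᵥ b ⨯₃ v) • v := by
  ext i
  fin_cases i <;> simp [cross_apply, dotProduct, Fin.sum_univ_three] <;> ring

theorem exists_triple_product_mul_cross (A B c x : Fin 3 → R) (i : Fin 3) :
    ∃ a b : R, (A ⬝ᵥ B ⨯₃ x) * (c ⨯₃ x) i = a * (A ⬝ᵥ c ⨯₃ x) + b * (B ⬝ᵥ c ⨯₃ x) := by
  refine ⟨(B ⨯₃ x) i, (x ⨯₃ A) i, ?_⟩
  fin_cases i <;> simp [cross_apply, dotProduct, Fin.sum_univ_three] <;> ring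

theorem gradient_cross_gradient (v : Fin 3 → R) (A B : Fin 3 → MvPolynomial (Fin 3) R) :
    gradient (A ⬝ᵥ (C ∘ v ⨯₃ X)) v ⨯₃ gradient (B ⬝ᵥ (C ∘ v ⨯₃ X)) v =
      eval v (A ⬝ᵥ B ⨯₃ X) • v := by
  rw [gradient_dotProduct_cross, gradient_dotProduct_cross, cross_cross_cross]
  simp [cross_apply, dotProduct, Fin.sum_univ_three]

theorem exists_eval_ne_zero_and_mul_mem_span_pair {K : Type*} [Field K]
    {f g : MvPolynomial (Fin 3) K} {d e : ℕ} (hf : f.IsHomogeneous d) (hg : g.IsHomogeneous e)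
    {v : Fin 3 → K} (hv : v ≠ 0) (hfv : eval v f = 0) (hgv : eval v g = 0)
    (hfg : LinearIndependent K ![gradient f v, gradient g v]) :
    ∃ s, eval v s ≠ 0 ∧ ∀ h ∈ pointIdeal v, s * h ∈ Ideal.span {f, g} := by
  obtain ⟨A, rfl⟩ := mem_pointIdeal_iff.1 (mem_pointIdeal_of_isHomogeneous hv hf hfv)
  obtain ⟨B, rfl⟩ := mem_pointIdeal_iff.1 (mem_pointIdeal_of_isHomogeneous hv hg hgv)
  refine ⟨A ⬝ᵥ B ⨯₃ X, ?_, fun h hh => ?_⟩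
  · rw [← crossProduct_ne_zero_iff_linearIndependent, gradient_cross_gradient] at hfg
    exact left_ne_zero_of_smul hfg
  · obtain ⟨a, rfl⟩ := mem_pointIdeal_iff.1 hh
    rw [dotProduct.eq_1 a, Finset.mul_sum]
    refine Ideal.sum_mem _ fun i _ => ?_
    obtain ⟨b, c, hbc⟩ := exists_triple_product_mul_cross A B (C ∘ v) X i
    rw [mul_left_comm, hbc]
    exact Ideal.mul_mem_left _ _ (Ideal.mem_span_pair.2 ⟨b, c, rfl⟩)

end LocalStructure

section Bezout

variable {K : Type*} [Field K]

/-- Transversality of plane curves over an arbitrary field; `Transverse` is the case of `ℂ`. -/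
def MeetTransversely (f g : MvPolynomial (Fin 3) K) : Prop :=
  ∀ v : Fin 3 → K, v ≠ 0 → eval v f = 0 → eval v g = 0 →
    LinearIndependent K ![gradient f v, gradient g v]

/-- The common zeros of `f` and `g` in projective space, tested on the homogeneous coordinates
`Projectivization.rep`. The choice of coordinates is irrelevant for homogeneous polynomials. -/
def commonZeros {σ : Type*} (f g : MvPolynomial σ K) : Set (ℙ K (σ → K)) :=
  {P | eval P.rep f = 0 ∧ eval P.rep g = 0}

theorem eval_rep_mk_eq_zero_iff {σ : Type*} {f : MvPolynomial σ K} {d : ℕ}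
    (hf : f.IsHomogeneous d) {v : σ → K} (hv : v ≠ 0) :
    eval (Projectivization.mk K v hv).rep f = 0 ↔ eval v f = 0 := by
  obtain ⟨a, ha⟩ := Projectivization.exists_smul_eq_mk_rep K v hv
  rw [← ha, Units.smul_def, eval_smul_of_isHomogeneous hf,
    mul_eq_zero_iff_left (pow_ne_zero d a.ne_zero)]

theorem gradient_mul_of_eval_eq_zero {σ R : Type*} [CommSemiring R] {h : MvPolynomial σ R}
    {x : σ → R} (hx : eval x h = 0) (a : MvPolynomial σ R) :
    gradient (h * a) x = eval x a • gradient h x := by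
  ext i
  simp [gradient, Derivation.leibniz, hx]

theorem span_pair_le_ker_evalRep {σ : Type*} {f g : MvPolynomial σ K} {T : Finset (ℙ K (σ → K))}
    (hT : (T : Set (ℙ K (σ → K))) ⊆ commonZeros f g) :
    (Ideal.span {f, g}).restrictScalars K ≤ LinearMap.ker (evalRep T) := by
  intro h hh
  obtain ⟨a, b, rfl⟩ := Ideal.mem_span_pair.1 hh
  refine mem_ker_evalRep.2 fun P hP => ?_
  obtain ⟨hfP, hgP⟩ := hT hP
  rw [map_add, map_mul, map_mul, hfP, hgP, mul_zero, mul_zero, add_zero]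

variable {f g : MvPolynomial (Fin 3) K} {d e : ℕ}

theorem MeetTransversely.exists_eval_ne_zero_and_mul_mem (hf : f.IsHomogeneous d)
    (hg : g.IsHomogeneous e) (hfg : MeetTransversely f g) {v : Fin 3 → K} (hv : v ≠ 0) :
    ∃ s, eval v s ≠ 0 ∧
      ∀ h ∈ ⨅ w ∈ {w : Fin 3 → K | w ≠ 0 ∧ eval w f = 0 ∧ eval w g = 0}, pointIdeal w,
        s * h ∈ Ideal.span {f, g} := by
  by_cases hfv : eval v f = 0
  · by_cases hgv : eval v g = 0
    · obtain ⟨s, hs, hsI⟩ :=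
        exists_eval_ne_zero_and_mul_mem_span_pair hf hg hv hfv hgv (hfg v hv hfv hgv)
      refine ⟨s, hs, fun h hh => hsI h ?_⟩
      simp only [Submodule.mem_iInf] at hh
      exact hh v ⟨hv, hfv, hgv⟩
    · exact ⟨g, hgv, fun h _ => Ideal.mul_mem_right _ _ (Ideal.subset_span (by simp))⟩
  · exact ⟨f, hfv, fun h _ => Ideal.mul_mem_right _ _ (Ideal.subset_span (by simp))⟩

theorem isUnit_of_idealOfVars_le_radical {σ : Type*} [Nontrivial σ] {h : MvPolynomial σ K}
    (hh : idealOfVars σ K ≤ (Ideal.span {h}).radical) : IsUnit h := by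
  have hdvd (i : σ) : ∃ n : ℕ, h ∣ X i ^ n := by
    obtain ⟨n, hn⟩ := hh (Ideal.subset_span ⟨i, rfl⟩)
    exact ⟨n, Ideal.mem_span_singleton.1 hn⟩
  obtain ⟨i, j, hij⟩ := exists_pair_ne σ
  obtain ⟨m, hm⟩ := hdvd i
  obtain ⟨n, hn⟩ := hdvd j
  have hrel : IsRelPrime (X i : MvPolynomial σ K) (X j) := by
    rwa [X_prime.irreducible.isRelPrime_iff_not_dvd, X_dvd_X]
  exact hrel.pow hm hn

variable [IsAlgClosed K]

theorem idealOfVars_le_radical {σ : Type*} [Finite σ]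
    {I : Ideal (MvPolynomial σ K)} (hI : ∀ v : σ → K, v ≠ 0 → ∃ s ∈ I, eval v s ≠ 0) :
    idealOfVars σ K ≤ I.radical := by
  rw [← vanishingIdeal_zeroLocus_eq_radical (K := K), Ideal.span_le]
  rintro _ ⟨i, rfl⟩ v hv
  rw [aeval_X]
  by_contra hvi
  obtain ⟨s, hs, hsv⟩ := hI v (fun h => hvi (by rw [h]; rfl))
  exact hsv (by simpa [coe_aeval_eq_eval] using hv s hs)

theorem MeetTransversely.isRelPrime (hfg : MeetTransversely f g) : IsRelPrime f g := by
  rintro h ⟨a, rfl⟩ ⟨b, rfl⟩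
  refine isUnit_of_idealOfVars_le_radical (idealOfVars_le_radical fun v hv =>
    ⟨h, Ideal.mem_span_singleton_self h, fun hhv => ?_⟩)
  have hli := hfg v hv (by simp [hhv]) (by simp [hhv])
  rw [gradient_mul_of_eval_eq_zero hhv, gradient_mul_of_eval_eq_zero hhv] at hli
  obtain ⟨-, ha⟩ := LinearIndependent.pair_iff.1 hli (eval v b) (-eval v a) (by module)
  exact hli.ne_zero 0 (by simp [neg_eq_zero.1 ha])

theorem MeetTransversely.exists_pow_mul_iInf_pointIdeal_le (hf : f.IsHomogeneous d)
    (hg : g.IsHomogeneous e) (hfg : MeetTransversely f g) :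
    ∃ N, idealOfVars (Fin 3) K ^ N *
      (⨅ w ∈ {w : Fin 3 → K | w ≠ 0 ∧ eval w f = 0 ∧ eval w g = 0}, pointIdeal w) ≤
        Ideal.span {f, g} := by
  set J := ⨅ w ∈ {w : Fin 3 → K | w ≠ 0 ∧ eval w f = 0 ∧ eval w g = 0}, pointIdeal w
  have hrad : idealOfVars (Fin 3) K ≤ ((Ideal.span {f, g}).colon (J : Set _)).radical :=
    idealOfVars_le_radical fun v hv => by
      obtain ⟨s, hs, hsJ⟩ := hfg.exists_eval_ne_zero_and_mul_mem hf hg hv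
      exact ⟨s, Submodule.mem_colon.2 hsJ, hs⟩
  obtain ⟨N, hN⟩ := Ideal.exists_pow_le_of_le_radical_of_fg hrad (idealOfVars_fg _ _)
  exact ⟨N, Ideal.mul_le.2 fun s hs h hh => Submodule.mem_colon.1 (hN hs) h hh⟩

theorem MeetTransversely.exists_forall_mem_span_pair (hf : f.IsHomogeneous d)
    (hg : g.IsHomogeneous e) (hfg : MeetTransversely f g) :
    ∃ n₀, ∀ n ≥ n₀, ∀ h : MvPolynomial (Fin 3) K, h.IsHomogeneous n →
      (∀ P ∈ commonZeros f g, eval P.rep h = 0) → h ∈ Ideal.span {f, g} := by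
  obtain ⟨N, hN⟩ := hfg.exists_pow_mul_iInf_pointIdeal_le hf hg
  obtain ⟨n₀, hn₀⟩ := exists_forall_isHomogeneous_mem (isHomogeneous_span_pair hf hg)
    (IsNoetherian.noetherian _) hN
  refine ⟨n₀, fun n hn h hh hzero => hn₀ n hn h ?_ hh⟩
  simp only [Submodule.mem_iInf]
  intro v ⟨hv, hfv, hgv⟩
  have hP : Projectivization.mk K v hv ∈ commonZeros f g :=
    ⟨(eval_rep_mk_eq_zero_iff hf hv).2 hfv, (eval_rep_mk_eq_zero_iff hg hv).2 hgv⟩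
  exact mem_pointIdeal_of_isHomogeneous hv hh ((eval_rep_mk_eq_zero_iff hh hv).1 (hzero _ hP))

theorem MeetTransversely.card_le_of_subset_commonZeros (hf : f.IsHomogeneous d)
    (hg : g.IsHomogeneous e) (hf0 : f ≠ 0) (hg0 : g ≠ 0) (hfg : MeetTransversely f g)
    {T : Finset (ℙ K (Fin 3 → K))} (hT : (T : Set (ℙ K (Fin 3 → K))) ⊆ commonZeros f g) :
    T.card ≤ d * e := by
  have heval := card_add_finrank_inf_ker_evalRep T (n := T.card + d + e) (by omega)
  have hhilb := finrank_span_pair_inf_add_mul hf hg hf0 hg0 hfg.isRelPrime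
    (n := T.card + d + e) (by omega)
  have hmono := Submodule.finrank_mono (inf_le_inf_right
    (homogeneousSubmodule (Fin 3) K (T.card + d + e)) (span_pair_le_ker_evalRep hT))
  omega

theorem MeetTransversely.finite_commonZeros (hf : f.IsHomogeneous d) (hg : g.IsHomogeneous e)
    (hf0 : f ≠ 0) (hg0 : g ≠ 0) (hfg : MeetTransversely f g) : (commonZeros f g).Finite := by
  by_contra hinf
  obtain ⟨T, hT, hcard⟩ := Set.Infinite.exists_subset_card_eq hinf (d * e + 1)
  have := hfg.card_le_of_subset_commonZeros hf hg hf0 hg0 hT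
  omega

theorem MeetTransversely.ncard_commonZeros (hf : f.IsHomogeneous d) (hg : g.IsHomogeneous e)
    (hf0 : f ≠ 0) (hg0 : g ≠ 0) (hfg : MeetTransversely f g) :
    (commonZeros f g).ncard = d * e := by
  obtain ⟨T, hT⟩ := (hfg.finite_commonZeros hf hg hf0 hg0).exists_finset_coe
  rw [← hT, Set.ncard_coe_finset]
  obtain ⟨n₀, hn₀⟩ := hfg.exists_forall_mem_span_pair hf hg
  set n := n₀ + T.card + d + e
  have hker : LinearMap.ker (evalRep T) ⊓ homogeneousSubmodule (Fin 3) K n ≤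
      (Ideal.span {f, g}).restrictScalars K ⊓ homogeneousSubmodule (Fin 3) K n :=
    fun h ⟨hhT, hh⟩ => ⟨hn₀ n (by omega) h hh (hT ▸ mem_ker_evalRep.1 hhT), hh⟩
  have hmono := Submodule.finrank_mono hker
  have heval := card_add_finrank_inf_ker_evalRep T (n := n) (by omega)
  have hhilb := finrank_span_pair_inf_add_mul hf hg hf0 hg0 hfg.isRelPrime (n := n) (by omega)
  have hle := hfg.card_le_of_subset_commonZeros hf hg hf0 hg0 hT.subset
  omega

end Bezout

section SymmetricCurves

theorem gradient_comp_of_isSymmetric {σ R : Type*} [CommSemiring R] {f : MvPolynomial σ R}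
    (hf : f.IsSymmetric) (τ : Equiv.Perm σ) (x : σ → R) :
    gradient f (x ∘ τ) = gradient f x ∘ τ := by
  ext i
  rw [gradient, ← eval_rename, ← pderiv_rename τ.injective, hf τ, Function.comp_apply, gradient]

theorem dotProduct_gradient {σ R : Type*} [Fintype σ] [CommSemiring R] {f : MvPolynomial σ R}
    {d : ℕ} (hf : f.IsHomogeneous d) (x : σ → R) : x ⬝ᵥ gradient f x = d * eval x f := by
  simpa [dotProduct, gradient] using congrArg (eval x) hf.sum_X_mul_pderiv

theorem cross_comp_perm {R : Type*} [CommRing R] (u w : Fin 3 → R) (τ : Equiv.Perm (Fin 3)) :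
    (u ∘ τ) ⨯₃ (w ∘ τ) = (Equiv.Perm.sign τ : R) • (u ⨯₃ w) ∘ τ := by
  ext i
  let M : Matrix (Fin 3) (Fin 3) R := ![Pi.single (τ i) 1, u, w]
  have hrows : M.submatrix id τ = ![Pi.single i 1, u ∘ τ, w ∘ τ] := by
    ext j k
    fin_cases j <;> simp [M, Matrix.submatrix, Pi.single_apply]
  calc ((u ∘ τ) ⨯₃ (w ∘ τ)) i
      = Pi.single i 1 ⬝ᵥ (u ∘ τ) ⨯₃ (w ∘ τ) := (single_one_dotProduct i _).symm
    _ = (M.submatrix id τ).det := by rw [triple_product_eq_det, hrows]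
    _ = Equiv.Perm.sign τ * M.det := Matrix.det_permute' τ M
    _ = Equiv.Perm.sign τ * (u ⨯₃ w) (τ i) := by
      rw [← triple_product_eq_det, single_one_dotProduct]

variable {K : Type*} [Field K]

theorem exists_smul_cross_eq {u w v : Fin 3 → K} (huw : LinearIndependent K ![u, w])
    (hu : v ⬝ᵥ u = 0) (hw : v ⬝ᵥ w = 0) : ∃ c : K, c • (u ⨯₃ w) = v := by
  have hcross : (u ⨯₃ w) ⨯₃ v = 0 := by
    rw [cross_cross_eq_smul_sub_smul, dotProduct_comm u, dotProduct_comm w, hu, hw, zero_smul,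
      zero_smul, sub_zero]
  by_contra! h
  exact crossProduct_ne_zero_iff_linearIndependent.2 ((LinearIndependent.pair_iff'
    (crossProduct_ne_zero_iff_linearIndependent.2 huw)).2 h) hcross

theorem MeetTransversely.comp_ne_self [NeZero (2 : K)] {f g : MvPolynomial (Fin 3) K} {d e : ℕ}
    (hfd : f.IsHomogeneous d) (hge : g.IsHomogeneous e) (hf : f.IsSymmetric) (hg : g.IsSymmetric)
    (hfg : MeetTransversely f g) {v : Fin 3 → K} (hv : v ≠ 0) (hfv : eval v f = 0)
    (hgv : eval v g = 0) {τ : Equiv.Perm (Fin 3)} (hτ : Equiv.Perm.sign τ = -1) : v ∘ τ ≠ v := by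
  intro hvτ
  have hcross : (gradient f v ⨯₃ gradient g v) ∘ τ = -(gradient f v ⨯₃ gradient g v) := by
    have := cross_comp_perm (gradient f v) (gradient g v) τ
    rw [← gradient_comp_of_isSymmetric hf, ← gradient_comp_of_isSymmetric hg, hvτ, hτ] at this
    rw [Units.val_neg, Units.val_one, Int.cast_neg, Int.cast_one, neg_one_smul] at this
    exact (neg_eq_iff_eq_neg.2 this).symm
  obtain ⟨c, hc⟩ := exists_smul_cross_eq (hfg v hv hfv hgv)
    (by rw [dotProduct_gradient hfd, hfv, mul_zero])
    (by rw [dotProduct_gradient hge, hgv, mul_zero])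
  have hneg : v = -v := by
    nth_rw 1 [← hvτ, ← hc]
    rw [Pi.smul_comp, hcross, smul_neg, hc]
  have h2v : (2 : K) • v = 0 := by
    rw [two_smul, ← eq_neg_iff_add_eq_zero]
    exact hneg
  exact hv ((smul_eq_zero_iff_right two_ne_zero).1 h2v)

end SymmetricCurves

section FixedPoints

theorem smul_eq_self_iff {σ : S3} {P : P2} : σ • P = P ↔ ∃ c : ℂ, P.rep ∘ σ = c • P.rep := by
  nth_rw 1 2 [← P.mk_rep]
  rw [smul_def, Projectivization.map_mk, eq_comm, Projectivization.mk_eq_mk_iff']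
  refine exists_congr fun c => ?_
  rw [eq_comm, funext_iff, funext_iff, ← σ.forall_congr_right]
  simp

/-- The point `[1 : -1 : 0]`. It is the only isolated fixed point of the transposition `(0 1)`;
the other fixed points form the line `x₀ = x₁`. -/
noncomputable def antiPoint : P2 := Projectivization.mk ℂ ![1, -1, 0] (by simp)

/-- The point `[1 : c : c ^ 2]`. For `c ^ 3 = 1` it is fixed by the three-cycle. -/
noncomputable def cyclicPoint (c : ℂ) : P2 := Projectivization.mk ℂ ![1, c, c ^ 2] (by simp)

theorem antiPoint_ne_cyclicPoint (c : ℂ) : antiPoint ≠ cyclicPoint c := by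
  rw [antiPoint, cyclicPoint, Ne, Projectivization.mk_eq_mk_iff']
  rintro ⟨a, ha⟩
  have h0 : a = 1 := by simpa using congrFun ha 0
  have h1 : c = -1 := by simpa [h0] using congrFun ha 1
  simpa [h0, h1] using congrFun ha 2

variable {K : Type*} [Field K] {v : Fin 3 → K} {c : K}

theorem eq_smul_of_comp_swap_eq_smul (hne : v ∘ Equiv.swap 0 1 ≠ v)
    (h : v ∘ Equiv.swap 0 1 = c • v) : v = v 0 • ![1, -1, 0] := by
  have hc : c - 1 ≠ 0 := fun hc => hne (by rw [h, sub_eq_zero.1 hc, one_smul])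
  have h0 : v 1 = c * v 0 := congrFun h 0
  have h1 : v 0 = c * v 1 := congrFun h 1
  have h2 : v 2 = c * v 2 := congrFun h 2
  have hv1 : v 1 = -v 0 := mul_left_cancel₀ hc (by linear_combination -h0 - h1)
  have hv2 : v 2 = 0 := mul_left_cancel₀ hc (by linear_combination -h2)
  ext i
  fin_cases i <;> simp [hv1, hv2]

theorem eq_smul_of_comp_finRotate_eq_smul (h : v ∘ finRotate 3 = c • v) :
    v = v 0 • ![1, c, c ^ 2] ∧ v 0 = c ^ 3 * v 0 := by
  have h0 : v 1 = c * v 0 := congrFun h 0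
  have h1 : v 2 = c * v 1 := congrFun h 1
  have h2 : v 0 = c * v 2 := congrFun h 2
  refine ⟨funext fun i => ?_, by linear_combination h2 + c * h1 + c ^ 2 * h0⟩
  fin_cases i <;> simp [h0, h1] <;> ring

theorem eq_antiPoint_of_smul_eq {P : P2} (hP : P.rep ∘ Equiv.swap 0 1 ≠ P.rep)
    (h : (Equiv.swap 0 1 : S3) • P = P) : P = antiPoint := by
  obtain ⟨c, hc⟩ := smul_eq_self_iff.1 h
  rw [← P.mk_rep, antiPoint, Projectivization.mk_eq_mk_iff']
  exact ⟨P.rep 0, (eq_smul_of_comp_swap_eq_smul hP hc).symm⟩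

theorem exists_primitiveRoot_of_smul_eq {P : P2} (hP : P.rep ∘ Equiv.swap 0 1 ≠ P.rep)
    (h : (finRotate 3 : S3) • P = P) : ∃ c ∈ primitiveRoots 3 ℂ, P = cyclicPoint c := by
  obtain ⟨c, hc⟩ := smul_eq_self_iff.1 h
  obtain ⟨hrep, hc3⟩ := eq_smul_of_comp_finRotate_eq_smul hc
  have h0 : P.rep 0 ≠ 0 := fun h0 => P.rep_nonzero (by rw [hrep, h0, zero_smul])
  have hc1 : c ≠ 1 := by
    rintro rfl
    refine hP (funext fun i => ?_)
    rw [hrep]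
    fin_cases i <;> simp [Equiv.swap_apply_of_ne_of_ne]
  have hroot : IsPrimitiveRoot c 3 :=
    IsPrimitiveRoot.iff_orderOf.2
      (orderOf_eq_prime (mul_right_cancel₀ h0 (by rw [← hc3, one_mul])) hc1)
  refine ⟨c, (mem_primitiveRoots three_pos).2 hroot, ?_⟩
  nth_rw 1 [← P.mk_rep]
  rw [cyclicPoint, Projectivization.mk_eq_mk_iff']
  exact ⟨P.rep 0, hrep.symm⟩

end FixedPoints

section OrbitDecomposition

variable {G X ι : Type*} [Group G] [MulAction G X]

theorem exists_sigma_quotient_equiv {H : ι → Subgroup G} {x : ι → X}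
    (hstab : ∀ i, MulAction.stabilizer G (x i) = H i)
    (hx : Function.Bijective fun i => (⟦x i⟧ : MulAction.orbitRel.Quotient G X)) :
    ∃ φ : (Σ i, G ⧸ H i) ≃ X, ∀ (g : G) y, φ (g • y) = g • φ y := by
  obtain rfl : (fun i => MulAction.stabilizer G (x i)) = H := funext hstab
  let φ (y : Σ i, G ⧸ MulAction.stabilizer G (x i)) : X :=
    MulAction.ofQuotientStabilizer G (x y.1) y.2
  have hmk (y) : (⟦φ y⟧ : MulAction.orbitRel.Quotient G X) = ⟦x y.1⟧ :=
    Quotient.sound (MulAction.ofQuotientStabilizer_mem_orbit G _ _)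
  have hinj : Function.Injective φ := by
    intro y z hyz
    have hfst : y.1 = z.1 := hx.injective (by simp only [← hmk, hyz])
    obtain ⟨i, c⟩ := y
    obtain ⟨j, c'⟩ := z
    obtain rfl : i = j := hfst
    exact congrArg (Sigma.mk i) (MulAction.injective_ofQuotientStabilizer G (x i) hyz)
  have hsurj : Function.Surjective φ := by
    intro y
    obtain ⟨i, hi⟩ := hx.surjective ⟦y⟧
    obtain ⟨g, hg⟩ := Quotient.exact hi.symm
    exact ⟨⟨i, g⟩, hg⟩
  exact ⟨.ofBijective φ ⟨hinj, hsurj⟩, fun g y => MulAction.ofQuotientStabilizer_smul G _ g y.2⟩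

theorem exists_fin_sum_equiv [Finite ι] {p q r : ι → Prop} (h : ∀ i, p i ∨ q i ∨ r i) :
    ∃ (k a b : ℕ) (ε : Fin k ⊕ Fin a ⊕ Fin b ≃ ι), (∀ i, p (ε (.inl i))) ∧
      (∀ i, q (ε (.inr (.inl i)))) ∧ ∀ i, r (ε (.inr (.inr i))) := by
  classical
  obtain ⟨k, ⟨εp⟩⟩ := Finite.exists_equiv_fin {i // p i}
  obtain ⟨a, ⟨εq⟩⟩ := Finite.exists_equiv_fin {i : {i // ¬ p i} // q i}
  obtain ⟨b, ⟨εr⟩⟩ := Finite.exists_equiv_fin {i : {i // ¬ p i} // ¬ q i}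
  refine ⟨k, a, b, (εp.symm.sumCongr ((εq.symm.sumCongr εr.symm).trans
    (Equiv.sumCompl fun i : {i // ¬ p i} => q i))).trans (Equiv.sumCompl p),
    fun i => (εp.symm i).2, fun i => (εq.symm i).2, fun i => ?_⟩
  exact ((h _).resolve_left (εr.symm i).1.2).resolve_left (εr.symm i).2

theorem isCoatom_of_prime_index {H : Subgroup G} (hH : H.index.Prime) : IsCoatom H := by
  refine ⟨fun h => hH.ne_one (Subgroup.index_eq_one.2 h), fun L hL => ?_⟩
  have hmul := Subgroup.relIndex_mul_index hL.le
  rcases (Nat.dvd_prime hH).1 (Dvd.intro_left _ hmul) with h1 | h1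
  · exact Subgroup.index_eq_one.1 h1
  · rw [h1, Nat.mul_eq_right hH.ne_zero, Subgroup.relIndex_eq_one] at hmul
    exact (hL.not_ge hmul).elim

end OrbitDecomposition

section SymmetricGroupSets

theorem index_C2 : C2.index = 3 := by
  have hmul := C2.index_mul_card
  rw [C2, Nat.card_zpowers, orderOf_eq_prime (p := 2) (by decide) (by decide),
    Nat.card_eq_fintype_card, Fintype.card_perm, Fintype.card_fin] at hmul
  exact Nat.mul_right_cancel two_pos hmul

theorem index_C3 : C3.index = 2 := by
  have hmul := C3.index_mul_card
  rw [C3, Nat.card_zpowers, orderOf_eq_prime (p := 3) (by decide) (by decide),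
    Nat.card_eq_fintype_card, Fintype.card_perm, Fintype.card_fin] at hmul
  exact Nat.mul_right_cancel three_pos hmul

theorem exists_conj_eq_swap_or_finRotate :
    ∀ g : S3, g ≠ 1 → ∃ σ : S3, σ * g * σ⁻¹ = Equiv.swap 0 1 ∨ σ * g * σ⁻¹ = finRotate 3 := by
  decide

variable {X : Type} [MulAction S3 X]

theorem exists_stabilizer_smul_eq {x : X} (hx : x ∉ MulAction.fixedPoints S3 X) :
    ∃ σ : S3, MulAction.stabilizer S3 (σ • x) = ⊥ ∨ MulAction.stabilizer S3 (σ • x) = C2 ∨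
      MulAction.stabilizer S3 (σ • x) = C3 := by
  rcases (MulAction.stabilizer S3 x).bot_or_exists_ne_one with hbot | ⟨g, hg, hg1⟩
  · exact ⟨1, .inl (by rw [one_smul, hbot])⟩
  obtain ⟨σ, hσ⟩ := exists_conj_eq_swap_or_finRotate g hg1
  have hmem : σ * g * σ⁻¹ ∈ MulAction.stabilizer S3 (σ • x) := by
    rw [MulAction.mem_stabilizer_iff, mul_smul, inv_smul_smul, mul_smul, hg]
  have htop : MulAction.stabilizer S3 (σ • x) ≠ ⊤ := fun h => by
    have hfix (τ : S3) : τ • σ • x = σ • x := h.ge (Subgroup.mem_top τ)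
    have hσx : x = σ • x := by rw [← hfix σ⁻¹, inv_smul_smul]
    exact hx fun τ => by rw [hσx, hfix]
  refine ⟨σ, .inr (hσ.imp (fun h => ?_) fun h => ?_)⟩ <;> rw [h, ← Subgroup.zpowers_le] at hmem
  · have hcoatom : IsCoatom C2 := isCoatom_of_prime_index (by rw [index_C2]; exact Nat.prime_three)
    exact (hcoatom.le_iff_eq htop).1 hmem
  · have hcoatom : IsCoatom C3 := isCoatom_of_prime_index (by rw [index_C3]; exact Nat.prime_two)
    exact (hcoatom.le_iff_eq htop).1 hmem

theorem exists_orbitSum_equiv_sigma (k a b : ℕ) :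
    ∃ ε : OrbitSum k a b ≃ Σ i : Fin k ⊕ Fin a ⊕ Fin b, S3 ⧸ Sum.elim (fun _ => (⊥ : Subgroup S3))
      (Sum.elim (fun _ => C2) fun _ => C3) i, ∀ (σ : S3) y, ε (σ • y) = σ • ε y := by
  let H : Fin k ⊕ Fin a ⊕ Fin b → Subgroup S3 :=
    Sum.elim (fun _ => ⊥) (Sum.elim (fun _ => C2) fun _ => C3)
  let ε₀ : (Σ _ : Fin k, S3) ≃ Σ i, S3 ⧸ H (.inl i) :=
    Equiv.sigmaCongrRight fun _ => QuotientGroup.quotientBot.symm.toEquiv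
  let ε₁ := Equiv.sumSigmaDistrib fun i => S3 ⧸ H (.inr i)
  refine ⟨(ε₀.sumCongr ε₁.symm).trans (Equiv.sumSigmaDistrib fun i => S3 ⧸ H i).symm, ?_⟩
  rintro σ (⟨i, τ⟩ | ⟨i, c⟩ | ⟨i, c⟩) <;> rfl

theorem exists_isomorphic_orbitSum [Finite X] (hX : MulAction.fixedPoints S3 X = ∅) :
    ∃ k a b, Isomorphic X (OrbitSum k a b) := by
  have : Finite (MulAction.orbitRel.Quotient S3 X) := Quotient.finite _
  have hrep (ω : MulAction.orbitRel.Quotient S3 X) : ∃ x : X, ⟦x⟧ = ω ∧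
      (MulAction.stabilizer S3 x = ⊥ ∨ MulAction.stabilizer S3 x = C2 ∨
        MulAction.stabilizer S3 x = C3) := by
    induction ω using Quotient.inductionOn with | h x => ?_
    obtain ⟨σ, hσ⟩ := exists_stabilizer_smul_eq (x := x) (hX ▸ Set.notMem_empty x)
    exact ⟨σ • x, Quotient.sound (MulAction.mem_orbit x σ), hσ⟩
  choose x hmk hstab using hrep
  obtain ⟨k, a, b, ε, hbot, h2, h3⟩ := exists_fin_sum_equiv hstab
  obtain ⟨φ, hφ⟩ := exists_sigma_quotient_equiv (x := x ∘ ε) (H := Sum.elim (fun _ => ⊥)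
    (Sum.elim (fun _ => C2) fun _ => C3)) (Sum.rec hbot (Sum.rec h2 h3))
    (by simpa only [Function.comp_apply, hmk] using ε.bijective)
  obtain ⟨ψ, hψ⟩ := exists_orbitSum_equiv_sigma k a b
  refine ⟨k, a, b, (ψ.trans φ).symm, fun σ y => ?_⟩
  rw [Equiv.symm_apply_eq, Equiv.trans_apply, hψ, hφ, ← Equiv.trans_apply, Equiv.apply_symm_apply]

theorem card_orbitSum (k a b : ℕ) : Nat.card (OrbitSum k a b) = 6 * k + 3 * a + 2 * b := by
  have h2 : Nat.card (S3 ⧸ C2) = 3 := index_C2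
  have h3 : Nat.card (S3 ⧸ C3) = 2 := index_C3
  have h6 : Nat.card S3 = 6 := by rw [Nat.card_eq_fintype_card, Fintype.card_perm]; rfl
  simp only [Nat.card_sum, Nat.card_sigma, h2, h3, h6, Finset.sum_const, Finset.card_univ,
    Fintype.card_fin, smul_eq_mul]
  ring

theorem le_card_fixedBy_swap_orbitSum (k a b : ℕ) :
    a ≤ Nat.card (MulAction.fixedBy (OrbitSum k a b) (Equiv.swap 0 1 : S3)) := by
  have hfix : (Equiv.swap 0 1 : S3) • ((1 : S3) : S3 ⧸ C2) = (1 : S3) :=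
    QuotientGroup.eq.2 (by simp [C2])
  let F (i : Fin a) : MulAction.fixedBy (OrbitSum k a b) (Equiv.swap 0 1 : S3) :=
    ⟨.inr (.inl ⟨i, (1 : S3)⟩), by simp [hfix]⟩
  have hF : Function.Injective F := fun i j h => by simpa [F] using h
  simpa using Nat.card_le_card_of_injective F hF

theorem finRotate_smul_quotient_C3 (c : S3 ⧸ C3) : (finRotate 3 : S3) • c = c := by
  have : C3.Normal := Subgroup.normal_of_index_eq_two index_C3
  induction c using QuotientGroup.induction_on with | H τ => ?_
  change ((finRotate 3 * τ : S3) : S3 ⧸ C3) = τ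
  rw [QuotientGroup.eq, mul_inv_rev]
  exact this.conj_mem' _ (inv_mem (Subgroup.mem_zpowers _)) τ

theorem two_mul_le_card_fixedBy_finRotate_orbitSum (k a b : ℕ) :
    2 * b ≤ Nat.card (MulAction.fixedBy (OrbitSum k a b) (finRotate 3 : S3)) := by
  let F (y : Fin b × (S3 ⧸ C3)) : MulAction.fixedBy (OrbitSum k a b) (finRotate 3 : S3) :=
    ⟨.inr (.inr ⟨y.1, y.2⟩), by simp [finRotate_smul_quotient_C3]⟩
  have hF : Function.Injective F := fun y z h => by simpa [F, Prod.ext_iff] using h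
  have hcard := Nat.card_le_card_of_injective F hF
  rwa [Nat.card_prod, Nat.card_fin, ← Subgroup.index, index_C3, mul_comm] at hcard

variable {Y : Type} [MulAction S3 Y]

theorem Isomorphic.card_eq (h : Isomorphic X Y) : Nat.card X = Nat.card Y :=
  Nat.card_congr h.choose

theorem Isomorphic.card_fixedBy_eq (h : Isomorphic X Y) (σ : S3) :
    Nat.card (MulAction.fixedBy X σ) = Nat.card (MulAction.fixedBy Y σ) := by
  obtain ⟨φ, hφ⟩ := h
  refine Nat.card_congr (φ.subtypeEquiv fun x => ?_)
  rw [MulAction.mem_fixedBy, MulAction.mem_fixedBy, ← hφ, φ.apply_eq_iff_eq]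

end SymmetricGroupSets

section IntersectionLocus

theorem zeroLocus_inter_zeroLocus {f g : MvPolynomial (Fin 3) ℂ} {d e : ℕ}
    (hfd : f.IsHomogeneous d) (hge : g.IsHomogeneous e) :
    zeroLocus f ∩ zeroLocus g = commonZeros f g := by
  ext P
  rw [← P.mk_rep, Set.mem_inter_iff, mk_mem_zeroLocus_iff hfd, mk_mem_zeroLocus_iff hge, P.mk_rep]
  rfl

variable {d e : ℕ} {f g : MvPolynomial (Fin 3) ℂ} (hfd : f.IsHomogeneous d)
  (hge : g.IsHomogeneous e) (hf : f.IsSymmetric) (hg : g.IsSymmetric)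

include hfd hge

theorem finite_intersectionLocus (hf0 : f ≠ 0) (hg0 : g ≠ 0) (hfg : Transverse f g) :
    Finite (intersectionLocus f g hf hg) := by
  have hfin := MeetTransversely.finite_commonZeros hfd hge hf0 hg0 hfg
  rwa [← zeroLocus_inter_zeroLocus hfd hge] at hfin

theorem card_intersectionLocus (hf0 : f ≠ 0) (hg0 : g ≠ 0) (hfg : Transverse f g) :
    Nat.card (intersectionLocus f g hf hg) = d * e := by
  rw [← MeetTransversely.ncard_commonZeros hfd hge hf0 hg0 hfg,
    ← zeroLocus_inter_zeroLocus hfd hge]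
  rfl

theorem rep_comp_swap_ne (hfg : Transverse f g) (P : intersectionLocus f g hf hg) :
    (P : P2).rep ∘ Equiv.swap 0 1 ≠ (P : P2).rep := by
  have hP : (P : P2) ∈ commonZeros f g := zeroLocus_inter_zeroLocus hfd hge ▸ P.2
  exact MeetTransversely.comp_ne_self hfd hge hf hg hfg P.1.rep_nonzero hP.1 hP.2
    (Equiv.Perm.sign_swap (by decide))

theorem card_fixedBy_swap_intersectionLocus_le (hfg : Transverse f g) :
    Nat.card (MulAction.fixedBy (intersectionLocus f g hf hg) (Equiv.swap 0 1 : S3)) ≤ 1 := by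
  have hanti (P : MulAction.fixedBy (intersectionLocus f g hf hg) (Equiv.swap 0 1 : S3)) :
      (P.1 : P2) = antiPoint :=
    eq_antiPoint_of_smul_eq (rep_comp_swap_ne hfd hge hf hg hfg P.1) (congrArg Subtype.val P.2)
  have : Subsingleton (MulAction.fixedBy (intersectionLocus f g hf hg) (Equiv.swap 0 1 : S3)) :=
    ⟨fun P Q => Subtype.ext (Subtype.ext ((hanti P).trans (hanti Q).symm))⟩
  exact Finite.card_le_one_iff_subsingleton.2 this

theorem card_fixedBy_finRotate_intersectionLocus_le (hfg : Transverse f g) :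
    Nat.card (MulAction.fixedBy (intersectionLocus f g hf hg) (finRotate 3 : S3)) ≤ 2 := by
  have hcyc (P : MulAction.fixedBy (intersectionLocus f g hf hg) (finRotate 3 : S3)) :
      ∃ c : primitiveRoots 3 ℂ, (P.1 : P2) = cyclicPoint c := by
    simpa using exists_primitiveRoot_of_smul_eq (rep_comp_swap_ne hfd hge hf hg hfg P.1)
      (congrArg Subtype.val P.2)
  choose F hF using hcyc
  have hinj : Function.Injective F := fun P Q hPQ =>
    Subtype.ext (Subtype.ext (by rw [hF, hF, hPQ]))
  have hcard := Nat.card_le_card_of_injective F hinj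
  rwa [Nat.card_eq_fintype_card (α := primitiveRoots 3 ℂ), Fintype.card_coe,
    Complex.card_primitiveRoots, Nat.totient_prime Nat.prime_three] at hcard

theorem fixedPoints_intersectionLocus_eq_empty (hfg : Transverse f g) :
    MulAction.fixedPoints S3 (intersectionLocus f g hf hg) = ∅ := by
  refine Set.eq_empty_of_forall_notMem fun P hP => ?_
  have hne := rep_comp_swap_ne hfd hge hf hg hfg P
  have hanti := eq_antiPoint_of_smul_eq hne (congrArg Subtype.val (hP (Equiv.swap 0 1)))
  obtain ⟨c, -, hc⟩ :=
    exists_primitiveRoot_of_smul_eq hne (congrArg Subtype.val (hP (finRotate 3)))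
  exact antiPoint_ne_cyclicPoint c (hanti.symm.trans hc)

theorem exists_isomorphic_intersectionLocus (hf0 : f ≠ 0) (hg0 : g ≠ 0)
    (hfg : Transverse f g) : ∃ k a b, a ≤ 1 ∧ b ≤ 1 ∧ d * e = 6 * k + 3 * a + 2 * b ∧
      Isomorphic (intersectionLocus f g hf hg) (OrbitSum k a b) := by
  have := finite_intersectionLocus hfd hge hf hg hf0 hg0 hfg
  obtain ⟨k, a, b, hiso⟩ :=
    exists_isomorphic_orbitSum (fixedPoints_intersectionLocus_eq_empty hfd hge hf hg hfg)
  have ha := le_card_fixedBy_swap_orbitSum k a b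
  have hb := two_mul_le_card_fixedBy_finRotate_orbitSum k a b
  rw [← hiso.card_fixedBy_eq] at ha hb
  have ha1 := ha.trans (card_fixedBy_swap_intersectionLocus_le hfd hge hf hg hfg)
  have hb1 := hb.trans (card_fixedBy_finRotate_intersectionLocus_le hfd hge hf hg hfg)
  refine ⟨k, a, b, ha1, by omega, ?_, hiso⟩
  rw [← card_intersectionLocus hfd hge hf hg hf0 hg0 hfg, hiso.card_eq, card_orbitSum]

end IntersectionLocus

end SymmetricBezout

theorem mainTheorem1 (d e : ℕ) (hd : 1 ≤ d) (he : 1 ≤ e) (f g : MvPolynomial (Fin 3) ℂ)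
    (hf0 : f ≠ 0) (hg0 : g ≠ 0)
    (hfd : f.IsHomogeneous d) (hge : g.IsHomogeneous e)
    (hf : f.IsSymmetric) (hg : g.IsSymmetric)
    (hfg : SymmetricBezout.Transverse f g) :
    ∀ k : ℕ,
      (d * e = 6 * k →
        SymmetricBezout.Isomorphic (SymmetricBezout.intersectionLocus f g hf hg)
          (SymmetricBezout.OrbitSum k 0 0)) ∧
      d * e ≠ 6 * k + 1 ∧
      (d * e = 6 * k + 2 →
        SymmetricBezout.Isomorphic (SymmetricBezout.intersectionLocus f g hf hg)
          (SymmetricBezout.OrbitSum k 0 1)) ∧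
      (d * e = 6 * k + 3 →
        SymmetricBezout.Isomorphic (SymmetricBezout.intersectionLocus f g hf hg)
          (SymmetricBezout.OrbitSum k 1 0)) ∧
      d * e ≠ 6 * k + 4 ∧
      (d * e = 6 * k + 5 →
        SymmetricBezout.Isomorphic (SymmetricBezout.intersectionLocus f g hf hg)
          (SymmetricBezout.OrbitSum k 1 1)) := by
  intro k
  obtain ⟨l, a, b, ha, hb, hcard, hiso⟩ :=
    SymmetricBezout.exists_isomorphic_intersectionLocus hfd hge hf hg hf0 hg0 hfg
  refine ⟨fun h => ?_, by omega, fun h => ?_, fun h => ?_, by omega, fun h => ?_⟩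
  · obtain ⟨rfl, rfl, rfl⟩ : k = l ∧ a = 0 ∧ b = 0 := by omega
    exact hiso
  · obtain ⟨rfl, rfl, rfl⟩ : k = l ∧ a = 0 ∧ b = 1 := by omega
    exact hiso
  · obtain ⟨rfl, rfl, rfl⟩ : k = l ∧ a = 1 ∧ b = 0 := by omega
    exact hiso
  · obtain ⟨rfl, rfl, rfl⟩ : k = l ∧ a = 1 ∧ b = 1 := by omega
    exact hiso
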